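/- Let $p$ be a probability distribution on $\mathcal X\times\{0,1\}\times\{0,1\}\ni(x,y,a)$ (input, label, protected attribute), let $\tau=\min\{\mathbb P_p(a=0),\mathbb P_p(a=1)\}>0$, and let $\mathcal H$ be a class of measurable functions $\mathcal X\to\{0,1\}$ of finite VC dimension $d$. Put $\mathcal R_p(f)=\mathbb P_p(f(x)\ne y)$ and $\Gamma_p(f)=|\mathbb P_p(f(x)=1\mid a=1)-\mathbb P_p(f(x)=1\mid a=0)|$. For a finite dataset $S$ (repetitions allowed) let $\mathcal R_S(f)$ and $\Gamma_S(f)$ be the same quantities with empirical frequencies (a rate in an empty group is $0$). For datasets $S,T$ let $$\mathrm{disc}(S,T)=\sup_{h\in\mathcal H}|\mathcal R_S(h)-\mathcal R_T(h)|,\quad \mathrm{disp}(S,T)=\sup_{h\in\mathcal H}|\Gamma_S(h)-\Gamma_T(h)|,\quad \mathrm{disb}(S,T)=\Big|\tfrac{|S^{a=1}|}{|S|}-\tfrac{|T^{a=1}|}{|T|}\Big|,$$ where $S^{a=1}$ is the part of $S$ with $a=1$; assume that $\mathrm{disc}$ and $\mathrm{disp}$ of two independent i.i.d. samples of size $n$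 from $p$ are measurable. Given $S_1,\dots,S_N$ and $\alpha$, let $D_{i,j}$ be the maximum of $\mathrm{disc},\mathrm{disp},\mathrm{disb}$ of $(S_i,S_j)$, let $q_i$ be the $\alpha$-quantile of $D_{i,1},\dots,D_{i,N}$, and let $\textsc{FilterSources}(S_1,\dots,S_N;\alpha)$ be the set of all $i$ such that $q_i$ is at most the $\alpha$-quantile of $q_1,\dots,q_N$; the $\alpha$-quantile of $N$ numbers is their $\lceil\alpha N\rceil$-th smallest. For all $d$ and $\tau$ there are functions $\varepsilon_{\mathcal R}(n),\varepsilon_\Gamma(n)=\widetilde{\mathcal O}(\sqrt{1/n})$ (that is, $O(\sqrt{1/n}\,(\log n)^k)$ for some $k$) such that for every $N$ and every $\delta>0$ there is a constant $C=C(\delta,\tau,d,N)$ for which the following holds for all $\mathcal X,p,\mathcal H$ as above, all $K>N/2$, all $\alpha\in[\frac12,\frac KN]$ and all $n\ge C$. Let $\tilde S_1,\dots,\tilde S_N$ be random datasets, each consisting of $n$ i.i.d. samples from $p$. Then with probability at least $1-\delta$: for all datasets $S_1,\dots,S_N$ of size $n$ with $S_i=\tilde S_i$ for at least $K$ indices $i$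 (that is, against any adversary who leaves at least $K$ sources unchanged), and for all $f\in\mathcal H$, the merged dataset $S=\bigcup_{i\in I}S_i$ (with multiplicities), $I=\textsc{FilterSources}(S_1,\dots,S_N;\alpha)$, satisfies $$\mathcal R_S(f)\le\mathcal R_p(f)+\varepsilon_{\mathcal R}(n)\qquad\text{and}\qquad \Gamma_S(f)\le\Gamma_p(f)+\varepsilon_\Gamma(n).$$ -/

import Mathlib

open MeasureTheory ProbabilityTheory Filter Asymptotics

noncomputable section

namespace FairMulti

/-- A labelled example `(x, y, a)`: input, binary label, binary protected attribute
(`true` is `1`, `false` is `0`). -/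
abbrev Ex (X : Type*) := X × Bool × Bool

/-- `H` shatters the finite set `s` if every subset of `s` is cut out by some `h ∈ H`. -/
def Shatters {X : Type*} (H : Set (X → Bool)) (s : Finset X) : Prop :=
  ∀ t : Finset X, t ⊆ s → ∃ h ∈ H, ∀ x ∈ s, (h x = true ↔ x ∈ t)

/-- The VC dimension: the supremum of the sizes of the finite shattered sets. -/
def vcDim {X : Type*} (H : Set (X → Bool)) : ℕ∞ :=
  ⨆ (s : Finset X) (_ : Shatters H s), (s.card : ℕ∞)

/-- The population risk `P(f(x) ≠ y)`. -/
def risk {X : Type*} [MeasurableSpace X] (p : Measure (Ex X)) (f : X → Bool) : ℝ :=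
  p.real {z | z.2.1 ≠ f z.1}

/-- `P(a = b)`. -/
def groupProb {X : Type*} [MeasurableSpace X] (p : Measure (Ex X)) (b : Bool) : ℝ :=
  p.real {z | z.2.2 = b}

/-- The acceptance rate `P(f(x) = 1 | a = b)` of `f` in the protected group `b`. -/
def groupRate {X : Type*} [MeasurableSpace X] (p : Measure (Ex X)) (f : X → Bool)
    (b : Bool) : ℝ :=
  (cond p {z | z.2.2 = b}).real {z | f z.1 = true}

/-- The population demographic parity violation. -/
def dpViolation {X : Type*} [MeasurableSpace X] (p : Measure (Ex X)) (f : X → Bool) : ℝ :=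
  |groupRate p f true - groupRate p f false|

/-- The empirical risk of `f` on a finite dataset (an indexed family, repetitions allowed). -/
def empRisk {X ι : Type*} [Fintype ι] (S : ι → Ex X) (f : X → Bool) : ℝ :=
  ((Finset.univ.filter fun k => (S k).2.1 ≠ f (S k).1).card : ℝ) / Fintype.card ι

/-- The number of examples of the dataset that belong to the protected group `b`. -/
def groupCount {X ι : Type*} [Fintype ι] (S : ι → Ex X) (b : Bool) : ℕ :=
  (Finset.univ.filter fun k => (S k).2.2 = b).card

/-- The empirical acceptance rate of `f` in the group `b` (`0` if the group is empty). -/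
def empGroupRate {X ι : Type*} [Fintype ι] (S : ι → Ex X) (f : X → Bool) (b : Bool) : ℝ :=
  ((Finset.univ.filter fun k => (S k).2.2 = b ∧ f (S k).1 = true).card : ℝ) / groupCount S b

/-- The empirical demographic parity violation. -/
def empDpViolation {X ι : Type*} [Fintype ι] (S : ι → Ex X) (f : X → Bool) : ℝ :=
  |empGroupRate S f true - empGroupRate S f false|

/-- The empirical discrepancy. -/
def disc {X ι κ : Type*} [Fintype ι] [Fintype κ] (H : Set (X → Bool))
    (S : ι → Ex X) (T : κ → Ex X) : ℝ :=
  ⨆ h : H, |empRisk S h - empRisk T h|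

/-- The empirical disparity. -/
def disp {X ι κ : Type*} [Fintype ι] [Fintype κ] (H : Set (X → Bool))
    (S : ι → Ex X) (T : κ → Ex X) : ℝ :=
  ⨆ h : H, |empDpViolation S h - empDpViolation T h|

/-- The empirical disbalance. -/
def disb {X ι κ : Type*} [Fintype ι] [Fintype κ] (S : ι → Ex X) (T : κ → Ex X) : ℝ :=
  |(groupCount S true : ℝ) / Fintype.card ι - (groupCount T true : ℝ) / Fintype.card κ|

/-- The dissimilarity score of two datasets. -/
def dScore {X ι κ : Type*} [Fintype ι] [Fintype κ] (H : Set (X → Bool))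
    (S : ι → Ex X) (T : κ → Ex X) : ℝ :=
  max (disc H S T) (max (disp H S T) (disb S T))

/-- The `α`-quantile of `v 0, …, v (N - 1)`: the smallest `t` such that at least `α * N` of the
values are `≤ t`, i.e. the `⌈α * N⌉`-th smallest value. -/
def quantile {N : ℕ} (α : ℝ) (v : Fin N → ℝ) : ℝ :=
  sInf {t : ℝ | α * N ≤ ((Finset.univ.filter fun i => v i ≤ t).card : ℝ)}

/-- The `q`-value of the source `i`. -/
def qValue {X : Type*} {N n : ℕ} (H : Set (X → Bool)) (α : ℝ)
    (S : Fin N → Fin n → Ex X) (i : Fin N) : ℝ :=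
  quantile α fun j => dScore H (S i) (S j)

/-- The set of the sources that are kept. -/
def filterSources {X : Type*} {N n : ℕ} (H : Set (X → Bool)) (α : ℝ)
    (S : Fin N → Fin n → Ex X) : Finset (Fin N) :=
  Finset.univ.filter fun i => qValue H α S i ≤ quantile α (qValue H α S)

/-- The dataset that merges the sources with index in `I`, with multiplicities. -/
def pool {X : Type*} {N n : ℕ} (S : Fin N → Fin n → Ex X) (I : Finset (Fin N)) :
    I × Fin n → Ex X :=
  fun k => S k.1 k.2

/-- `S` is a possible output of an adversary that leaves at least `K` sources unchanged. -/
def IsCorruption {X : Type*} {N n : ℕ} (K : ℕ) (clean S : Fin N → Fin n → Ex X) : Prop :=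
  ∃ G : Finset (Fin N), K ≤ G.card ∧ ∀ i ∈ G, S i = clean i

/-- Landau's `O` up to logarithmic factors: `ε n = O(g n * (log n) ^ k)` for some `k`. -/
def SoftO (ε g : ℕ → ℝ) : Prop :=
  ∃ k : ℕ, ε =O[atTop] fun n => g n * Real.log n ^ k

end FairMulti

end

open MeasureTheory ProbabilityTheory FairMulti

/-!
A sample of size `n` is *representative* if, uniformly over `H`, its empirical risk and parity
violation are within `2 * ε` of the population values and so is its proportion of the protected
group, where `ε = √(1 / n) * log n`. The proof has a deterministic and a probabilistic half.

*Deterministic half.* Suppose that all clean sources are representative. Two clean sources have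
dissimilarity at most `4 * ε`, and there are at least `K ≥ α * N` of them, so clean `q`-values, and
therefore the quantile of all `q`-values, are at most `4 * ε`. A source that passes the filter,
corrupted or not, is thus within `4 * ε` of at least `α * N ≥ N / 2` sources. As `K > N / 2`, one of
these is clean, so the source is within `6 * ε` of the population
(`isRepresentative_of_mem_filterSources`). The risk of the merged dataset is the average of the
risks of the sources. Its acceptance rates are weighted averages, but the weights are nearly uniform
because the group proportions nearly agree, so the parity violation is nearly bounded by the average
parity violation (`empDpViolation_pool_le`).

*Probabilistic half.* That a sample is representative with high probability is the
Vapnik-Chervonenkis theorem. Only the suprema over pairs of samples are known to be measurable, so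
the argument works with outer measures: symmetrization (`measure_le_two_mul_prod`) bounds the outer
measure of the bad samples by the measure of a null-measurable event about two samples, which
exchangeability reduces to a count over swaps of two fixed samples (`measure_le_of_card_swapBy_le`).
The count is a union bound over the traces of `H`, polynomially many by Sauer-Shelah, with
Hoeffding's inequality for each of them (`card_swapBy_le`). The resulting failure probability, of
order `n ^ d * exp (-c * (log n) ^ 2) + 1 / (log n) ^ 2`, tends to `0`. The sources need not be
independent of one another: a union bound over them suffices.
-/

/-! ### Empirical means of indicators -/

namespace FairMulti

/-- The empirical mean of `φ` over a finite dataset (`0` for the empty dataset). -/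
noncomputable def empMean {Z ι : Type*} [Fintype ι] (φ : Z → ℝ) (S : ι → Z) : ℝ :=
  (∑ k, φ (S k)) / Fintype.card ι

/-- The indicator of the misclassified examples. -/
def errInd {X : Type*} (f : X → Bool) (z : Ex X) : ℝ := if z.2.1 ≠ f z.1 then 1 else 0

/-- The indicator of the group `b`. -/
def grpInd {X : Type*} (b : Bool) (z : Ex X) : ℝ := if z.2.2 = b then 1 else 0

/-- The indicator of the accepted examples of the group `b`. -/
def accInd {X : Type*} (b : Bool) (f : X → Bool) (z : Ex X) : ℝ :=
  if z.2.2 = b ∧ f z.1 = true then 1 else 0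

section Indicators

variable {X ι : Type*} [Fintype ι]

lemma errInd_mem_Icc (f : X → Bool) (z : Ex X) : errInd f z ∈ Set.Icc (0 : ℝ) 1 := by
  unfold errInd; split_ifs <;> simp

lemma grpInd_mem_Icc (b : Bool) (z : Ex X) : grpInd b z ∈ Set.Icc (0 : ℝ) 1 := by
  unfold grpInd; split_ifs <;> simp

lemma accInd_mem_Icc (b : Bool) (f : X → Bool) (z : Ex X) :
    accInd b f z ∈ Set.Icc (0 : ℝ) 1 := by
  unfold accInd; split_ifs <;> simp

lemma accInd_le_grpInd (b : Bool) (f : X → Bool) (z : Ex X) : accInd b f z ≤ grpInd b z := by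
  unfold accInd grpInd; split_ifs <;> simp_all

lemma empMean_mem_Icc {Z : Type*} {φ : Z → ℝ} (hφ : ∀ z, φ z ∈ Set.Icc (0 : ℝ) 1) (S : ι → Z) :
    empMean φ S ∈ Set.Icc (0 : ℝ) 1 := by
  refine ⟨div_nonneg (Finset.sum_nonneg fun k _ => (hφ _).1) (by positivity),
    div_le_one_of_le₀ ?_ (by positivity)⟩
  exact (Finset.sum_le_sum fun k _ => (hφ (S k)).2).trans (by simp)

lemma empMean_mono {Z : Type*} {φ ψ : Z → ℝ} (h : ∀ z, φ z ≤ ψ z) (S : ι → Z) :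
    empMean φ S ≤ empMean ψ S :=
  div_le_div_of_nonneg_right (Finset.sum_le_sum fun _ _ => h _) (by positivity)

lemma empRisk_eq (S : ι → Ex X) (f : X → Bool) : empRisk S f = empMean (errInd f) S := by
  simp [empRisk, empMean, errInd, Finset.sum_ite]

lemma groupCount_div_eq (S : ι → Ex X) (b : Bool) :
    (groupCount S b : ℝ) / Fintype.card ι = empMean (grpInd b) S := by
  simp [groupCount, empMean, grpInd]

lemma empGroupRate_eq (S : ι → Ex X) (f : X → Bool) (b : Bool) :
    empGroupRate S f b = empMean (accInd b f) S / empMean (grpInd b) S := by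
  rcases isEmpty_or_nonempty ι with h | h
  · simp [empGroupRate, empMean]
  · have : (Fintype.card ι : ℝ) ≠ 0 := by simp
    rw [← groupCount_div_eq, empMean, div_div_div_cancel_right₀ this]
    simp [empGroupRate, accInd]

lemma empGroupRate_mem_Icc (S : ι → Ex X) (f : X → Bool) (b : Bool) :
    empGroupRate S f b ∈ Set.Icc (0 : ℝ) 1 := by
  rw [empGroupRate_eq]
  exact ⟨div_nonneg (empMean_mem_Icc (accInd_mem_Icc b f) S).1
      (empMean_mem_Icc (grpInd_mem_Icc b) S).1,
    div_le_one_of_le₀ (empMean_mono (accInd_le_grpInd b f) S)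
      (empMean_mem_Icc (grpInd_mem_Icc b) S).1⟩

lemma empRisk_mem_Icc (S : ι → Ex X) (f : X → Bool) : empRisk S f ∈ Set.Icc (0 : ℝ) 1 :=
  empRisk_eq S f ▸ empMean_mem_Icc (errInd_mem_Icc f) S

lemma empDpViolation_mem_Icc (S : ι → Ex X) (f : X → Bool) :
    empDpViolation S f ∈ Set.Icc (0 : ℝ) 1 := by
  have h1 := empGroupRate_mem_Icc S f true
  have h0 := empGroupRate_mem_Icc S f false
  exact ⟨abs_nonneg _, abs_le.2 ⟨by linarith [h1.1, h0.2], by linarith [h1.2, h0.1]⟩⟩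

lemma empMean_grpInd_false [Nonempty ι] (S : ι → Ex X) :
    empMean (grpInd false) S = 1 - empMean (grpInd true) S := by
  have h0 : (Fintype.card ι : ℝ) ≠ 0 := by simp
  have : ∀ z : Ex X, grpInd false z = 1 - grpInd true z := by
    intro z; unfold grpInd; cases z.2.2 <;> simp
  unfold empMean
  simp only [this, Finset.sum_sub_distrib]
  field_simp
  simp

/-- The mean over a merged dataset is the average of the means over the sources. -/
lemma empMean_pool {N n : ℕ} (φ : Ex X → ℝ) (S : Fin N → Fin n → Ex X) (I : Finset (Fin N)) :
    empMean φ (pool S I) = (∑ i ∈ I, empMean φ (S i)) / I.card := by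
  unfold empMean pool
  rw [Fintype.sum_prod_type, ← Finset.sum_div, Finset.sum_coe_sort I fun i => ∑ k, φ (S i k)]
  simp only [Fintype.card_prod, Fintype.card_coe, Fintype.card_fin, Nat.cast_mul]
  rw [div_div, mul_comm]

end Indicators

/-! ### Population quantities as expectations -/

section Population

variable {X : Type*} [MeasurableSpace X] {f : X → Bool}

lemma measurable_errInd (hf : Measurable f) : Measurable (errInd f) := by
  refine Measurable.ite ?_ measurable_const measurable_const
  exact (measurableSet_eq_fun (by fun_prop) (by fun_prop)).compl

lemma measurable_grpInd (b : Bool) : Measurable (grpInd (X := X) b) :=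
  Measurable.ite (measurableSet_eq_fun (by fun_prop) (by fun_prop)) measurable_const
    measurable_const

lemma measurable_accInd (b : Bool) (hf : Measurable f) : Measurable (accInd b f) :=
  Measurable.ite ((measurableSet_eq_fun (by fun_prop) (by fun_prop)).inter
    (measurableSet_eq_fun (by fun_prop) (by fun_prop))) measurable_const measurable_const

lemma measurable_empMean {Z : Type*} [MeasurableSpace Z] {n : ℕ} {φ : Z → ℝ}
    (hφ : Measurable φ) : Measurable fun s : Fin n → Z => empMean φ s := by
  unfold empMean; fun_prop

variable (p : Measure (Ex X))

lemma risk_eq_integral (hf : Measurable f) : risk p f = ∫ z, errInd f z ∂p := by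
  have hm : MeasurableSet {z : Ex X | z.2.1 ≠ f z.1} :=
    (measurableSet_eq_fun (by fun_prop) (by fun_prop)).compl
  have := integral_indicator_one (μ := p) hm
  rw [risk, ← this]
  simp [Set.indicator_apply, errInd]

lemma groupProb_eq_integral (b : Bool) : groupProb p b = ∫ z, grpInd b z ∂p := by
  have hm : MeasurableSet {z : Ex X | z.2.2 = b} := measurableSet_eq_fun (by fun_prop) (by fun_prop)
  have := integral_indicator_one (μ := p) hm
  rw [groupProb, ← this]
  simp [Set.indicator_apply, grpInd]

lemma groupRate_eq_integral (hf : Measurable f) (b : Bool) :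
    groupRate p f b = (∫ z, accInd b f z ∂p) / ∫ z, grpInd b z ∂p := by
  have hm : MeasurableSet {z : Ex X | z.2.2 = b} := measurableSet_eq_fun (by fun_prop) (by fun_prop)
  have hm' : MeasurableSet {z : Ex X | f z.1 = true} :=
    measurableSet_eq_fun (by fun_prop) (by fun_prop)
  have := integral_indicator_one (μ := p) (hm.inter hm')
  rw [groupRate, measureReal_def, cond_apply hm, ENNReal.toReal_mul, ENNReal.toReal_inv,
    ← measureReal_def, ← measureReal_def, ← this, ← groupProb_eq_integral, groupProb,
    div_eq_inv_mul]
  simp [Set.indicator_apply, accInd]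

end Population

/-! ### Elementary estimates for conditional rates -/

/-- A quotient `x / y ∈ [0, 1]` is stable in terms of the second denominator only; in particular
`y = 0` is harmless. -/
lemma abs_div_sub_div_le {x y a b : ℝ} (hx : 0 ≤ x) (hxy : x ≤ y) (hb : 0 < b) :
    |x / y - a / b| ≤ (|y - b| + |x - a|) / b := by
  have hy : 0 ≤ y := hx.trans hxy
  have hr0 : 0 ≤ x / y := div_nonneg hx hy
  have hr1 : x / y ≤ 1 := div_le_one_of_le₀ hxy hy
  have hxr : x = x / y * y := by
    rcases hy.eq_or_lt with h | h
    · have : x = 0 := le_antisymm (h ▸ hxy) hx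
      simp [this]
    · field_simp
  set r := x / y
  have h1 : r - a / b = (r * (b - y) + (x - a)) / b := by
    rw [hxr]; field_simp; ring
  rw [h1, abs_div, abs_of_pos hb]
  gcongr
  refine (abs_add_le _ _).trans (add_le_add ?_ le_rfl)
  rw [abs_mul, abs_of_nonneg hr0, abs_sub_comm b y]
  exact mul_le_of_le_one_left (abs_nonneg _) hr1

lemma abs_abs_sub_sub_abs_sub_le (a b c d : ℝ) : |(|a - b| - |c - d|)| ≤ |a - c| + |b - d| := by
  refine (abs_abs_sub_abs_le _ _).trans ?_
  rw [show a - b - (c - d) = (a - c) - (b - d) by ring]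
  exact abs_sub _ _

/-! ### Quantiles -/

section Quantile

variable {N : ℕ} {α : ℝ} {v : Fin N → ℝ} {t : ℝ}

lemma quantile_le (h0 : 0 < α * N)
    (h : α * N ≤ ((Finset.univ.filter fun i => v i ≤ t).card : ℝ)) : quantile α v ≤ t := by
  refine csInf_le ⟨-∑ i, |v i|, fun s hs => ?_⟩ h
  have hpos : 0 < (Finset.univ.filter fun i => v i ≤ s).card := by
    exact_mod_cast h0.trans_le hs
  obtain ⟨i, hi⟩ := Finset.card_pos.1 hpos
  have h1 := Finset.single_le_sum (f := fun i => |v i|) (fun _ _ => abs_nonneg _)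
    (Finset.mem_univ i)
  have h2 := neg_abs_le (v i)
  have h3 := (Finset.mem_filter.1 hi).2
  linarith

/-- The infimum defining the quantile is attained. -/
lemma le_card_of_quantile_le (h1 : α * N ≤ N) (h : quantile α v ≤ t) :
    α * N ≤ ((Finset.univ.filter fun i => v i ≤ t).card : ℝ) := by
  have hne : {t : ℝ | α * N ≤ ((Finset.univ.filter fun i => v i ≤ t).card : ℝ)}.Nonempty := by
    refine ⟨∑ i, |v i|, ?_⟩
    have : (Finset.univ.filter fun i => v i ≤ ∑ i, |v i|) = Finset.univ := by
      refine Finset.filter_true_of_mem fun i _ => (le_abs_self _).trans ?_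
      exact Finset.single_le_sum (f := fun i => |v i|) (fun _ _ => abs_nonneg _)
        (Finset.mem_univ i)
    simp only [Set.mem_ofPred_eq, this]
    simpa using h1
  -- no value of `v` lies in `(t, u)` for some `u > t`
  have hev : ∀ᶠ s in nhdsWithin t (Set.Ioi t), ∀ i, v i ≤ s → v i ≤ t := by
    refine Filter.eventually_all.2 fun i => ?_
    rcases le_or_gt (v i) t with hi | hi
    · exact Filter.Eventually.of_forall fun _ _ => hi
    · filter_upwards [Ioo_mem_nhdsGT hi] with s hs hs'
      exact absurd hs' (not_le.2 hs.2)
  obtain ⟨u, hu, hsub⟩ := mem_nhdsGT_iff_exists_Ioo_subset.1 hev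
  obtain ⟨s, hs, hsu⟩ := exists_lt_of_csInf_lt hne (lt_of_le_of_lt h hu)
  refine le_trans hs ?_
  norm_cast
  refine Finset.card_le_card fun i hi => ?_
  simp only [Finset.mem_filter, Finset.mem_univ, true_and] at hi ⊢
  rcases le_or_gt s t with hst | hst
  · exact hi.trans hst
  · exact hsub ⟨hst, hsu⟩ i hi

end Quantile

/-! ### What the filter guarantees -/

section Filter

variable {X : Type*} {N n K : ℕ} {α : ℝ} {H : Set (X → Bool)}

lemma abs_empRisk_sub_le_disc {ι κ : Type*} [Fintype ι] [Fintype κ] (S : ι → Ex X)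
    (T : κ → Ex X) {h : X → Bool} (hh : h ∈ H) : |empRisk S h - empRisk T h| ≤ disc H S T := by
  refine le_ciSup (f := fun h : H => |empRisk S h - empRisk T h|) ⟨1, ?_⟩ ⟨h, hh⟩
  rintro _ ⟨g, rfl⟩
  have h1 := empRisk_mem_Icc S g
  have h0 := empRisk_mem_Icc T g
  exact abs_le.2 ⟨by linarith [h1.1, h0.2], by linarith [h1.2, h0.1]⟩

lemma abs_empDpViolation_sub_le_disp {ι κ : Type*} [Fintype ι] [Fintype κ] (S : ι → Ex X)
    (T : κ → Ex X) {h : X → Bool} (hh : h ∈ H) :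
    |empDpViolation S h - empDpViolation T h| ≤ disp H S T := by
  refine le_ciSup (f := fun h : H => |empDpViolation S h - empDpViolation T h|) ⟨1, ?_⟩ ⟨h, hh⟩
  rintro _ ⟨g, rfl⟩
  have h1 := empDpViolation_mem_Icc S g
  have h0 := empDpViolation_mem_Icc T g
  exact abs_le.2 ⟨by linarith [h1.1, h0.2], by linarith [h1.2, h0.1]⟩

/-- `S` represents the reference values `R`, `Γ` (of risk and parity violation) and `π` (of the
proportion of the group `true`) up to `η`, uniformly over `H`. -/
def IsRepresentative {ι : Type*} [Fintype ι] (H : Set (X → Bool)) (R Γ : (X → Bool) → ℝ)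
    (π η : ℝ) (S : ι → Ex X) : Prop :=
  (∀ h ∈ H, |empRisk S h - R h| ≤ η) ∧ (∀ h ∈ H, |empDpViolation S h - Γ h| ≤ η) ∧
    |empMean (grpInd true) S - π| ≤ η

variable {R Γ : (X → Bool) → ℝ} {π η θ : ℝ}

lemma IsRepresentative.dScore_le {ι κ : Type*} [Fintype ι] [Fintype κ] {S : ι → Ex X}
    {T : κ → Ex X} (hη : 0 ≤ η) (hS : IsRepresentative H R Γ π η S)
    (hT : IsRepresentative H R Γ π η T) : dScore H S T ≤ 2 * η := by
  have tri : ∀ {a b c : ℝ}, |a - c| ≤ η → |b - c| ≤ η → |a - b| ≤ 2 * η := by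
    intro a b c h1 h2
    have := abs_sub_le a c b
    rw [abs_sub_comm c b] at this
    linarith
  refine max_le (Real.iSup_le (fun h => tri (hS.1 h h.2) (hT.1 h h.2)) (by linarith))
    (max_le (Real.iSup_le (fun h => tri (hS.2.1 h h.2) (hT.2.1 h h.2)) (by linarith)) ?_)
  rw [disb, groupCount_div_eq, groupCount_div_eq]
  exact tri hS.2.2 hT.2.2

lemma IsRepresentative.of_dScore_le {ι κ : Type*} [Fintype ι] [Fintype κ] {S : ι → Ex X}
    {T : κ → Ex X} (hT : IsRepresentative H R Γ π η T) (h : dScore H S T ≤ θ) :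
    IsRepresentative H R Γ π (θ + η) S := by
  have h1 : disc H S T ≤ θ := (le_max_left _ _).trans h
  have h2 : disp H S T ≤ θ := ((le_max_left _ _).trans (le_max_right _ _)).trans h
  have h3 : disb S T ≤ θ := ((le_max_right _ _).trans (le_max_right _ _)).trans h
  rw [disb, groupCount_div_eq, groupCount_div_eq] at h3
  refine ⟨fun f hf => ?_, fun f hf => ?_, (abs_sub_le _ _ _).trans (add_le_add h3 hT.2.2)⟩
  · exact (abs_sub_le _ _ _).trans
      (add_le_add ((abs_empRisk_sub_le_disc S T hf).trans h1) (hT.1 f hf))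
  · exact (abs_sub_le _ _ _).trans
      (add_le_add ((abs_empDpViolation_sub_le_disp S T hf).trans h2) (hT.2.1 f hf))

/-- Every source that passes the filter, corrupted or not, is representative: it is close to at
least `α * N ≥ N / 2` sources, hence to one of the more than `N / 2` representative ones. -/
lemma isRepresentative_of_mem_filterSources {S : Fin N → Fin n → Ex X} (hη : 0 ≤ η)
    (hK : (N : ℝ) / 2 < K) (hα : 1 / 2 ≤ α) (hαK : α ≤ (K : ℝ) / N) {G : Finset (Fin N)}
    (hG : K ≤ G.card) (hrep : ∀ i ∈ G, IsRepresentative H R Γ π η (S i)) {i : Fin N}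
    (hi : i ∈ filterSources H α S) : IsRepresentative H R Γ π (3 * η) (S i) := by
  have hN : (0 : ℝ) < N := by exact_mod_cast i.pos
  have hαN : α * N ≤ K := by rwa [le_div_iff₀ hN] at hαK
  have hGN : G.card ≤ N := by simpa using G.card_le_univ
  have hGK : (K : ℝ) ≤ G.card := by exact_mod_cast hG
  have h1 : α * N ≤ N := by
    have : (G.card : ℝ) ≤ N := by exact_mod_cast hGN
    linarith
  have h0 : 0 < α * N := by positivity
  have hq : ∀ j ∈ G, qValue H α S j ≤ 2 * η := by
    intro j hj
    refine quantile_le h0 (hαN.trans (hGK.trans ?_))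
    norm_cast
    exact Finset.card_le_card fun k hk => Finset.mem_filter.2
      ⟨Finset.mem_univ _, (hrep j hj).dScore_le hη (hrep k hk)⟩
  have hqq : quantile α (qValue H α S) ≤ 2 * η := by
    refine quantile_le h0 (hαN.trans (hGK.trans ?_))
    norm_cast
    exact Finset.card_le_card fun k hk => Finset.mem_filter.2 ⟨Finset.mem_univ _, hq k hk⟩
  have hc := le_card_of_quantile_le h1 (((Finset.mem_filter.1 hi).2).trans hqq)
  obtain ⟨j, hjG, hj⟩ : ∃ j ∈ G, dScore H (S i) (S j) ≤ 2 * η := by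
    by_contra! hcon
    have hdis : Disjoint G (Finset.univ.filter fun j => dScore H (S i) (S j) ≤ 2 * η) := by
      rw [Finset.disjoint_left]
      intro j hj hj'
      exact (hcon j hj).not_ge (Finset.mem_filter.1 hj').2
    have hcard := Finset.card_union_of_disjoint hdis
    have hle := (G ∪ Finset.univ.filter fun j => dScore H (S i) (S j) ≤ 2 * η).card_le_univ
    rw [hcard, Fintype.card_fin] at hle
    have hle' : (G.card : ℝ) +
        (Finset.univ.filter fun j => dScore H (S i) (S j) ≤ 2 * η).card ≤ N := by
      exact_mod_cast hle
    nlinarith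
  have := (hrep j hjG).of_dScore_le hj
  rwa [show 2 * η + η = 3 * η by ring] at this

lemma empRisk_pool_le {S : Fin N → Fin n → Ex X} {I : Finset (Fin N)} {f : X → Bool} {c : ℝ}
    (hc : 0 ≤ c) (h : ∀ i ∈ I, empRisk (S i) f ≤ c) : empRisk (pool S I) f ≤ c := by
  simp only [empRisk_eq, empMean_pool] at h ⊢
  refine div_le_of_le_mul₀ (by positivity) hc ((Finset.sum_le_card_nsmul _ _ _ h).trans ?_)
  rw [nsmul_eq_mul, mul_comm]

/-- If the proportions of the group `b` in the sources are close to a common `π`, then all sources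
have almost the same weight in the acceptance rate of the merged dataset. -/
lemma abs_empGroupRate_pool_sub_le {S : Fin N → Fin n → Ex X} {I : Finset (Fin N)}
    (hI : I.Nonempty) (f : X → Bool) {b : Bool} (hπ : 0 < π)
    (h : ∀ i ∈ I, |empMean (grpInd b) (S i) - π| ≤ η) :
    |empGroupRate (pool S I) f b - (∑ i ∈ I, empGroupRate (S i) f b) / I.card| ≤ 2 * η / π := by
  have hm : (0 : ℝ) < I.card := by exact_mod_cast hI.card_pos
  have avg : ∀ u v : Fin N → ℝ, (∀ i ∈ I, |u i - v i| ≤ η) →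
      |(∑ i ∈ I, u i) / I.card - (∑ i ∈ I, v i) / I.card| ≤ η := by
    intro u v huv
    rw [← sub_div, ← Finset.sum_sub_distrib, abs_div, abs_of_pos hm, div_le_iff₀ hm]
    refine (Finset.abs_sum_le_sum_abs _ _).trans ((Finset.sum_le_card_nsmul _ _ _ huv).trans ?_)
    rw [nsmul_eq_mul, mul_comm]
  have hx := (empMean_mem_Icc (accInd_mem_Icc b f) (pool S I)).1
  have hxy := empMean_mono (accInd_le_grpInd b f) (pool S I)
  have key := abs_div_sub_div_le (a := (∑ i ∈ I, empGroupRate (S i) f b * π) / I.card)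
    hx hxy hπ
  rw [← empGroupRate_eq, ← Finset.sum_mul, mul_div_right_comm, mul_div_cancel_right₀ _ hπ.ne']
    at key
  refine key.trans (div_le_div_of_nonneg_right ?_ hπ.le)
  rw [two_mul]
  refine add_le_add ?_ ?_
  · have := avg (fun i => empMean (grpInd b) (S i)) (fun _ => π) h
    rwa [Finset.sum_const, nsmul_eq_mul, mul_div_cancel_left₀ _ hm.ne', ← empMean_pool] at this
  · rw [empMean_pool, ← mul_div_right_comm, Finset.sum_mul]
    refine avg _ _ fun i hi => ?_
    have hr := empGroupRate_mem_Icc (S i) f b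
    have hxr : empMean (accInd b f) (S i) =
        empGroupRate (S i) f b * empMean (grpInd b) (S i) := by
      rw [empGroupRate_eq]
      rcases eq_or_ne (empMean (grpInd b) (S i)) 0 with h0 | h0
      · rw [h0, mul_zero]
        exact le_antisymm (h0 ▸ empMean_mono (accInd_le_grpInd b f) (S i))
          (empMean_mem_Icc (accInd_mem_Icc b f) (S i)).1
      · rw [div_mul_cancel₀ _ h0]
    rw [hxr, ← mul_sub, abs_mul, abs_of_nonneg hr.1]
    exact (mul_le_of_le_one_left (abs_nonneg _) hr.2).trans (h i hi)

lemma empDpViolation_pool_le {S : Fin N → Fin n → Ex X} {I : Finset (Fin N)} {f : X → Bool}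
    {π : Bool → ℝ} {c τ : ℝ} (hc : 0 ≤ c) (hη : 0 ≤ η) (hτ : 0 < τ) (hπ : ∀ b, τ ≤ π b)
    (hb : ∀ b, ∀ i ∈ I, |empMean (grpInd b) (S i) - π b| ≤ η)
    (h : ∀ i ∈ I, empDpViolation (S i) f ≤ c) :
    empDpViolation (pool S I) f ≤ c + 4 * η / τ := by
  rcases I.eq_empty_or_nonempty with rfl | hI
  · have : empDpViolation (pool S ∅) f = 0 := by
      simp [empDpViolation, empGroupRate_eq, empMean_pool]
    rw [this]
    positivity
  have hm : (0 : ℝ) < I.card := by exact_mod_cast hI.card_pos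
  have hrate : ∀ b, |empGroupRate (pool S I) f b - (∑ i ∈ I, empGroupRate (S i) f b) / I.card| ≤
      2 * η / τ := fun b =>
    (abs_empGroupRate_pool_sub_le hI f (hτ.trans_le (hπ b)) (hb b)).trans
      (div_le_div_of_nonneg_left (by positivity) hτ (hπ b))
  have havg : |(∑ i ∈ I, empGroupRate (S i) f true) / I.card -
      (∑ i ∈ I, empGroupRate (S i) f false) / I.card| ≤ c := by
    rw [← sub_div, ← Finset.sum_sub_distrib, abs_div, abs_of_pos hm, div_le_iff₀ hm]
    refine (Finset.abs_sum_le_sum_abs _ _).trans ((Finset.sum_le_card_nsmul _ _ _ h).trans ?_)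
    rw [nsmul_eq_mul, mul_comm]
  have h1 := (le_abs_self _).trans (abs_abs_sub_sub_abs_sub_le (empGroupRate (pool S I) f true)
    (empGroupRate (pool S I) f false) ((∑ i ∈ I, empGroupRate (S i) f true) / I.card)
    ((∑ i ∈ I, empGroupRate (S i) f false) / I.card))
  have h2 := hrate true
  have h3 := hrate false
  have h4 : 4 * η / τ = 2 * η / τ + 2 * η / τ := by ring
  unfold empDpViolation
  linarith

end Filter

/-! ### Growth function and random swaps -/

open scoped Classical in
/-- The subsets of the index set `ι` that `H` cuts out of the family of points `x`. -/
noncomputable def traceFamily {X ι : Type*} [Fintype ι] (H : Set (X → Bool)) (x : ι → X) :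
    Finset (Finset ι) :=
  Finset.univ.filter fun A => ∃ h ∈ H, ∀ k, k ∈ A ↔ h (x k) = true

lemma Shatters.card_le_of_vcDim_eq {X : Type*} {H : Set (X → Bool)} {d : ℕ} (hd : vcDim H = d)
    {s : Finset X} (hs : Shatters H s) : s.card ≤ d := by
  have : (s.card : ℕ∞) ≤ vcDim H := le_iSup₂ (f := fun (s : Finset X) (_ : Shatters H s) =>
    (s.card : ℕ∞)) s hs
  rw [hd] at this
  exact_mod_cast this

open scoped Classical in
lemma vcDim_traceFamily_le {X ι : Type*} [Fintype ι] {H : Set (X → Bool)} {d : ℕ}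
    (hd : vcDim H = d) (x : ι → X) : (traceFamily H x).vcDim ≤ d := by
  refine Finset.sup_le fun s hs => ?_
  rw [Finset.mem_shatterer] at hs
  have htr : ∀ t ⊆ s, ∃ h ∈ H, ∀ k ∈ s, (h (x k) = true ↔ k ∈ t) := by
    intro t ht
    obtain ⟨u, hu, hut⟩ := hs ht
    obtain ⟨h, hh, hu⟩ := (Finset.mem_filter.1 hu).2
    refine ⟨h, hh, fun k hk => ?_⟩
    rw [← hu, ← hut, Finset.mem_inter]
    tauto
  have hinj : Set.InjOn x s := by
    intro k hk l hl hkl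
    obtain ⟨h, -, ht⟩ := htr {k} (by simpa using hk)
    have := (ht l hl).1 (hkl ▸ (ht k hk).2 (by simp))
    simpa [eq_comm] using this
  rw [← Finset.card_image_of_injOn hinj]
  refine Shatters.card_le_of_vcDim_eq hd fun t ht => ?_
  obtain ⟨h, hh, hk⟩ := htr (s.filter fun k => x k ∈ t) (Finset.filter_subset _ _)
  refine ⟨h, hh, fun y hy => ?_⟩
  obtain ⟨k, hks, rfl⟩ := Finset.mem_image.1 hy
  rw [hk k hks, Finset.mem_filter]
  tauto

/-- A crude polynomial form of the Sauer-Shelah lemma. -/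
lemma card_traceFamily_le {X ι : Type*} [Fintype ι] [Nonempty ι] {H : Set (X → Bool)} {d : ℕ}
    (hd : vcDim H = d) (x : ι → X) :
    (traceFamily H x).card ≤ (d + 1) * Fintype.card ι ^ d := by
  classical
  have h1 := (Finset.card_le_card_shatterer (traceFamily H x)).trans
    (Finset.card_shatterer_le_sum_vcDim)
  refine h1.trans ?_
  calc _ ≤ ∑ k ∈ Finset.Iic d, (Fintype.card ι).choose k :=
        Finset.sum_le_sum_of_subset (Finset.Iic_subset_Iic.2 (by
          convert vcDim_traceFamily_le hd x))
    _ ≤ ∑ k ∈ Finset.Iic d, Fintype.card ι ^ d := by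
        refine Finset.sum_le_sum fun k hk => (Nat.choose_le_pow _ _).trans ?_
        exact Nat.pow_le_pow_right Fintype.card_pos (Finset.mem_Iic.1 hk)
    _ = _ := by simp

/-- The Rademacher sign of a Boolean. -/
def sign (b : Bool) : ℝ := if b then 1 else -1

lemma sum_exp_sign_mul_le {n : ℕ} {a : Fin n → ℝ} (ha : ∀ k, |a k| ≤ 1) (l : ℝ) :
    ∑ σ : Fin n → Bool, Real.exp (l * ∑ k, sign (σ k) * a k) ≤
      2 ^ n * Real.exp (n * l ^ 2 / 2) := by
  have h1 : ∀ σ : Fin n → Bool, Real.exp (l * ∑ k, sign (σ k) * a k) =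
      ∏ k, Real.exp (sign (σ k) * (l * a k)) := by
    intro σ
    rw [← Real.exp_sum, Finset.mul_sum]
    congr 1
    exact Finset.sum_congr rfl fun k _ => by ring
  have h2 : ∑ σ : Fin n → Bool, Real.exp (l * ∑ k, sign (σ k) * a k) =
      ∏ k, ∑ b : Bool, Real.exp (sign b * (l * a k)) := by
    rw [Finset.prod_univ_sum, Fintype.piFinset_univ]
    exact Finset.sum_congr rfl fun σ _ => h1 σ
  rw [h2]
  calc _ ≤ ∏ k : Fin n, 2 * Real.exp (l ^ 2 / 2) := by
        refine Finset.prod_le_prod (fun k _ => Finset.sum_nonneg fun _ _ => (Real.exp_pos _).le)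
          fun k _ => ?_
        have hc := Real.cosh_le_exp_half_sq (l * a k)
        have hl : (l * a k) ^ 2 ≤ l ^ 2 := by
          have : a k ^ 2 ≤ 1 := (sq_le_one_iff_abs_le_one _).2 (ha k)
          nlinarith [sq_nonneg l]
        have he : Real.exp ((l * a k) ^ 2 / 2) ≤ Real.exp (l ^ 2 / 2) := by gcongr
        rw [Real.cosh_eq] at hc
        simp only [Fintype.sum_bool, sign]
        norm_num
        linarith
    _ = _ := by
        rw [Finset.prod_const, mul_pow, ← Real.exp_nat_mul]
        simp [mul_div_assoc]

/-- Hoeffding's inequality for Rademacher sums, as a count of sign vectors. -/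
lemma card_sign_sum_le {n : ℕ} {a : Fin n → ℝ} (ha : ∀ k, |a k| ≤ 1) {ε : ℝ}
    (hε : 0 ≤ ε) :
    ((Finset.univ.filter fun σ : Fin n → Bool => n * ε < |∑ k, sign (σ k) * a k|).card : ℝ) ≤
      2 ^ n * (2 * Real.exp (-(n * ε ^ 2 / 2))) := by
  have one : ∀ a : Fin n → ℝ, (∀ k, |a k| ≤ 1) →
      ((Finset.univ.filter fun σ : Fin n → Bool => n * ε < ∑ k, sign (σ k) * a k).card : ℝ) ≤
        2 ^ n * Real.exp (-(n * ε ^ 2 / 2)) := by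
    intro a ha
    -- Chernoff bound with the optimal exponent `ε`
    have h1 := sum_exp_sign_mul_le ha ε
    have h2 : ((Finset.univ.filter fun σ : Fin n → Bool =>
        n * ε < ∑ k, sign (σ k) * a k).card : ℝ) * Real.exp (ε * (n * ε)) ≤
        ∑ σ : Fin n → Bool, Real.exp (ε * ∑ k, sign (σ k) * a k) := by
      rw [Finset.card_filter, Nat.cast_sum, Finset.sum_mul]
      refine Finset.sum_le_sum fun σ _ => ?_
      split_ifs with hσ
      · rw [Nat.cast_one, one_mul]
        exact Real.exp_le_exp.2 (mul_le_mul_of_nonneg_left hσ.le hε)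
      · simpa using (Real.exp_pos _).le
    rw [← le_div_iff₀ (Real.exp_pos _)] at h2
    refine h2.trans ((div_le_div_of_nonneg_right h1 (Real.exp_pos _).le).trans_eq ?_)
    rw [mul_div_assoc, ← Real.exp_sub]
    congr 2
    ring
  have hsub : (Finset.univ.filter fun σ : Fin n → Bool => n * ε < |∑ k, sign (σ k) * a k|) ⊆
      (Finset.univ.filter fun σ : Fin n → Bool => n * ε < ∑ k, sign (σ k) * a k) ∪
      (Finset.univ.filter fun σ : Fin n → Bool => n * ε < ∑ k, sign (σ k) * (-a k)) := by
    intro σ hσ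
    simp only [Finset.mem_union, Finset.mem_filter, Finset.mem_univ, true_and, mul_neg,
      Finset.sum_neg_distrib] at hσ ⊢
    exact lt_abs.1 hσ
  have hcard := (Finset.card_le_card hsub).trans (Finset.card_union_le _ _)
  have h1 := one a ha
  have h2 := one (fun k => -a k) fun k => by rw [abs_neg]; exact ha k
  have : ((Finset.univ.filter fun σ : Fin n → Bool =>
      n * ε < |∑ k, sign (σ k) * a k|).card : ℝ) ≤ _ := Nat.cast_le.2 hcard
  push_cast at this
  linarith

/-- Exchange the `k`-th entries of the two samples for every `k` with `σ k = false`. -/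
def swapBy {Z : Type*} {n : ℕ} (σ : Fin n → Bool) (s : (Fin n → Z) × (Fin n → Z)) :
    (Fin n → Z) × (Fin n → Z) :=
  (fun k => if σ k then s.1 k else s.2 k, fun k => if σ k then s.2 k else s.1 k)

lemma empMean_swapBy_sub {Z : Type*} {n : ℕ} (φ : Z → ℝ) (σ : Fin n → Bool)
    (s : (Fin n → Z) × (Fin n → Z)) :
    empMean φ (swapBy σ s).1 - empMean φ (swapBy σ s).2 =
      (∑ k, sign (σ k) * (φ (s.1 k) - φ (s.2 k))) / n := by
  simp only [empMean, Fintype.card_fin]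
  rw [← sub_div, ← Finset.sum_sub_distrib]
  congr 1
  refine Finset.sum_congr rfl fun k _ => ?_
  simp only [swapBy, sign]
  split_ifs <;> ring

/-- The Vapnik-Chervonenkis bound for the deviation `ε` of two samples of size `n`. -/
noncomputable def vcTail (d n : ℕ) (ε : ℝ) : ℝ :=
  (d + 1) * (2 * n) ^ d * (2 * Real.exp (-(n * ε ^ 2 / 2)))

lemma vcTail_nonneg (d n : ℕ) (ε : ℝ) : 0 ≤ vcTail d n ε := by unfold vcTail; positivity

open scoped Classical in
/-- Among all swaps of two fixed samples, few make the means of `φ h` differ by more than `ε` for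
some `h ∈ H`: only the trace of `H` on the `2 * n` inputs matters, so this is a union bound over
polynomially many applications of Hoeffding's inequality. -/
lemma card_swapBy_le {X Y : Type*} {H : Set (X → Bool)} {d n : ℕ} (hd : vcDim H = d) (hn : 0 < n)
    {φ : (X → Bool) → X × Y → ℝ} (hφ : ∀ h z, φ h z ∈ Set.Icc (0 : ℝ) 1)
    (hloc : ∀ h h' z, h z.1 = h' z.1 → φ h z = φ h' z) {ε : ℝ} (hε : 0 ≤ ε)
    (s : (Fin n → X × Y) × (Fin n → X × Y)) :
    ((Finset.univ.filter fun σ : Fin n → Bool => ∃ h ∈ H,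
      ε < |empMean (φ h) (swapBy σ s).1 - empMean (φ h) (swapBy σ s).2|).card : ℝ) ≤
      2 ^ n * vcTail d n ε := by
  have hn' : (0 : ℝ) < n := by exact_mod_cast hn
  have : Nonempty (Fin n ⊕ Fin n) := ⟨.inl ⟨0, hn⟩⟩
  let x : Fin n ⊕ Fin n → X := Sum.elim (fun k => (s.1 k).1) (fun k => (s.2 k).1)
  have hrep : ∀ A ∈ traceFamily H x, ∃ h ∈ H, ∀ k, k ∈ A ↔ h (x k) = true := fun A hA =>
    (Finset.mem_filter.1 hA).2
  choose! r hrH hr using hrep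
  have hsub : (Finset.univ.filter fun σ : Fin n → Bool => ∃ h ∈ H,
      ε < |empMean (φ h) (swapBy σ s).1 - empMean (φ h) (swapBy σ s).2|) ⊆
      (traceFamily H x).biUnion fun A => Finset.univ.filter fun σ : Fin n → Bool =>
        n * ε < |∑ k, sign (σ k) * (φ (r A) (s.1 k) - φ (r A) (s.2 k))| := by
    intro σ hσ
    obtain ⟨h, hh, hlt⟩ := (Finset.mem_filter.1 hσ).2
    have hA : (Finset.univ.filter fun k => h (x k) = true) ∈ traceFamily H x :=
      Finset.mem_filter.2 ⟨Finset.mem_univ _, h, hh, fun k => by simp⟩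
    refine Finset.mem_biUnion.2 ⟨_, hA, Finset.mem_filter.2 ⟨Finset.mem_univ _, ?_⟩⟩
    have heq : ∀ k, h (x k) = r (Finset.univ.filter fun k => h (x k) = true) (x k) := by
      intro k
      have := hr _ hA k
      rw [Finset.mem_filter] at this
      rw [Bool.eq_iff_iff, ← this]
      simp
    rw [empMean_swapBy_sub, abs_div, abs_of_pos hn', lt_div_iff₀ hn', mul_comm] at hlt
    refine hlt.trans_eq (congrArg _ (Finset.sum_congr rfl fun k _ => ?_))
    rw [hloc _ _ _ (heq (.inl k)), hloc _ _ _ (heq (.inr k))]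
  have h1 := (Finset.card_le_card hsub).trans Finset.card_biUnion_le
  have h2 : ((Finset.univ.filter fun σ : Fin n → Bool => ∃ h ∈ H,
      ε < |empMean (φ h) (swapBy σ s).1 - empMean (φ h) (swapBy σ s).2|).card : ℝ) ≤ _ :=
    Nat.cast_le.2 h1
  push_cast at h2
  refine h2.trans ((Finset.sum_le_card_nsmul _ _ _ fun A _ => card_sign_sum_le (fun k => ?_)
    hε).trans ?_)
  · have h1 := hφ (r A) (s.1 k)
    have h0 := hφ (r A) (s.2 k)
    exact abs_le.2 ⟨by linarith [h1.1, h0.2], by linarith [h1.2, h0.1]⟩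
  · have hc : ((traceFamily H x).card : ℝ) ≤ (d + 1) * (2 * n) ^ d := by
      have : ((traceFamily H x).card : ℝ) ≤ _ := Nat.cast_le.2 (card_traceFamily_le hd x)
      push_cast [Fintype.card_sum, Fintype.card_fin] at this
      rwa [← two_mul] at this
    rw [nsmul_eq_mul, vcTail, mul_left_comm]
    gcongr

/-! ### Chebyshev's inequality, symmetrization and swaps under product measures -/

section Symmetrization

variable {Z : Type*} [MeasurableSpace Z] (p : Measure Z) [IsProbabilityMeasure p] {n : ℕ}

lemma measure_empMean_dev_le {φ : Z → ℝ} (hm : Measurable φ)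
    (hφ : ∀ z, φ z ∈ Set.Icc (0 : ℝ) 1) (hn : 0 < n) {c : ℝ} (hc : 0 < c) :
    Measure.pi (fun _ : Fin n => p) {s | c ≤ |empMean φ s - ∫ z, φ z ∂p|} ≤
      ENNReal.ofReal (1 / (n * c ^ 2)) := by
  have hn' : (0 : ℝ) < n := by exact_mod_cast hn
  have hL : MemLp φ 2 p := memLp_of_bounded (Filter.Eventually.of_forall hφ)
    hm.aestronglyMeasurable 2
  have hmean : (Measure.pi fun _ : Fin n => p)[fun s => empMean φ s] = ∫ z, φ z ∂p := by
    have hi : ∀ k ∈ (Finset.univ : Finset (Fin n)),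
        Integrable (fun s : Fin n → Z => φ (s k)) (Measure.pi fun _ => p) := fun k _ =>
      (hL.comp_measurePreserving (measurePreserving_eval (fun _ : Fin n => p) k)).integrable
        (by norm_num)
    simp only [empMean, Fintype.card_fin]
    rw [integral_div, integral_finsetSum _ hi]
    simp_rw [integral_comp_eval (μ := fun _ : Fin n => p) hm.aestronglyMeasurable]
    rw [Finset.sum_const, nsmul_eq_mul, Finset.card_univ, Fintype.card_fin,
      mul_div_cancel_left₀ _ hn'.ne']
  have hvar : Var[fun s => empMean φ s; Measure.pi fun _ : Fin n => p] ≤ 1 / n := by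
    have h1 := variance_sum_pi (μ := fun _ : Fin n => p) (X := fun _ => φ) fun _ => hL
    have h2 := variance_le_sq_of_bounded (μ := p) (Filter.Eventually.of_forall hφ)
      hm.aemeasurable
    have h3 : (fun s : Fin n → Z => empMean φ s) =
        fun s => (n : ℝ)⁻¹ * (∑ k : Fin n, fun s : Fin n → Z => φ (s k)) s := by
      funext s
      simp [empMean, div_eq_inv_mul]
    rw [h3, variance_const_mul, h1, Finset.sum_const, nsmul_eq_mul, Finset.card_univ,
      Fintype.card_fin]
    have h4 : ((n : ℝ)⁻¹) ^ 2 * (n * Var[φ; p]) = Var[φ; p] / n := by field_simp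
    rw [h4]
    gcongr
    linarith
  have hLs : MemLp (fun s : Fin n → Z => empMean φ s) 2 (Measure.pi fun _ => p) :=
    memLp_of_bounded (Filter.Eventually.of_forall fun s => empMean_mem_Icc hφ s)
      (measurable_empMean hm).aestronglyMeasurable 2
  have key := meas_ge_le_variance_div_sq hLs hc
  rw [hmean] at key
  refine key.trans (ENNReal.ofReal_le_ofReal ?_)
  rw [← div_div]
  gcongr

/-- If every section of `B` over a point of `A` has probability at least `1 / 2`, then `A` has
outer measure at most twice the measure of `B`. Neither `A` nor the sections need be measurable. -/
lemma measure_le_two_mul_prod {α : Type*} [MeasurableSpace α] {μ : Measure α}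
    [IsProbabilityMeasure μ] {A : Set α} {B : Set (α × α)}
    (h : ∀ s ∈ A, 2⁻¹ ≤ μ {t | (s, t) ∈ B}) : μ A ≤ 2 * μ.prod μ B := by
  have hm := measurableSet_toMeasurable (μ.prod μ) B
  have hmeas : Measurable fun s => μ (Prod.mk s ⁻¹' toMeasurable (μ.prod μ) B) :=
    measurable_measure_prodMk_left hm
  have hA : A ⊆ {s | 2⁻¹ ≤ μ (Prod.mk s ⁻¹' toMeasurable (μ.prod μ) B)} := fun s hs =>
    (h s hs).trans (measure_mono fun t ht => subset_toMeasurable _ _ ht)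
  have hmarkov := mul_meas_ge_le_lintegral (μ := μ) hmeas 2⁻¹
  rw [← Measure.prod_apply hm, measure_toMeasurable] at hmarkov
  calc μ A ≤ μ {s | 2⁻¹ ≤ μ (Prod.mk s ⁻¹' toMeasurable (μ.prod μ) B)} := measure_mono hA
    _ = 2 * (2⁻¹ * μ {s | 2⁻¹ ≤ μ (Prod.mk s ⁻¹' toMeasurable (μ.prod μ) B)}) := by
        rw [← mul_assoc, ENNReal.mul_inv_cancel (by norm_num) (by norm_num), one_mul]
    _ ≤ _ := by gcongr

lemma measurePreserving_swapBy (σ : Fin n → Bool) :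
    MeasurePreserving (swapBy (Z := Z) σ)
      ((Measure.pi fun _ : Fin n => p).prod (Measure.pi fun _ : Fin n => p))
      ((Measure.pi fun _ : Fin n => p).prod (Measure.pi fun _ : Fin n => p)) := by
  have h1 := measurePreserving_arrowProdEquivProdArrow Z Z (Fin n) (fun _ => p) (fun _ => p)
  have h2 : MeasurePreserving
      (fun (z : Fin n → Z × Z) k => (if σ k then id else Prod.swap) (z k))
      (Measure.pi fun _ : Fin n => p.prod p) (Measure.pi fun _ : Fin n => p.prod p) := by
    refine measurePreserving_pi (fun _ => p.prod p) (fun _ => p.prod p)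
      (f := fun k => if σ k then id else Prod.swap) fun k => ?_
    split_ifs
    · exact MeasurePreserving.id _
    · exact Measure.measurePreserving_swap
  have h3 := (h1.comp h2).comp (h1.symm)
  convert h3 using 1
  funext s
  refine Prod.ext (funext fun k => ?_) (funext fun k => ?_) <;>
  · simp only [swapBy, Function.comp, MeasurableEquiv.arrowProdEquivProdArrow]
    cases hk : σ k <;> simp [hk, Equiv.arrowProdEquivProdArrow]

open scoped Classical in
/-- Two independent samples are exchangeable, so an event has at most the probability that it has
under a uniformly random swap of the worst pair of samples. -/
lemma measure_le_of_card_swapBy_le {B : Set ((Fin n → Z) × (Fin n → Z))}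
    (hB : NullMeasurableSet B
      ((Measure.pi fun _ : Fin n => p).prod (Measure.pi fun _ : Fin n => p))) {c : ℝ}
    (h : ∀ s, ((Finset.univ.filter fun σ : Fin n → Bool => swapBy σ s ∈ B).card : ℝ) ≤
      2 ^ n * c) :
    (Measure.pi fun _ : Fin n => p).prod (Measure.pi fun _ : Fin n => p) B ≤
      ENNReal.ofReal c := by
  set μ := (Measure.pi fun _ : Fin n => p).prod (Measure.pi fun _ : Fin n => p)
  obtain ⟨B', hsub, hB', hae⟩ := hB.exists_measurable_subset_ae_eq
  have hpre : ∀ σ : Fin n → Bool, MeasurableSet (swapBy (Z := Z) σ ⁻¹' B') := fun σ =>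
    (measurePreserving_swapBy p σ).measurable hB'
  have h1 : (2 : ENNReal) ^ n * μ B ≤ (2 : ENNReal) ^ n * ENNReal.ofReal c := by
    calc (2 : ENNReal) ^ n * μ B = ∑ σ : Fin n → Bool, μ (swapBy σ ⁻¹' B') := by
          have : ∀ σ : Fin n → Bool, μ (swapBy σ ⁻¹' B') = μ B := fun σ => by
            rw [(measurePreserving_swapBy p σ).measure_preimage hB'.nullMeasurableSet,
              measure_congr hae]
          simp [this]
      _ = ∑ σ : Fin n → Bool, ∫⁻ s, (swapBy σ ⁻¹' B').indicator 1 s ∂μ := by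
          refine Finset.sum_congr rfl fun σ _ => ?_
          rw [lintegral_indicator_one (hpre σ)]
      _ = ∫⁻ s, ∑ σ : Fin n → Bool, (swapBy σ ⁻¹' B').indicator 1 s ∂μ := by
          rw [lintegral_finsetSum _ fun σ _ => measurable_one.indicator (hpre σ)]
      _ ≤ ∫⁻ _, (2 : ENNReal) ^ n * ENNReal.ofReal c ∂μ := by
          refine lintegral_mono fun s => ?_
          have h2 : ∑ σ : Fin n → Bool,
              (swapBy σ ⁻¹' B').indicator (1 : (Fin n → Z) × (Fin n → Z) → ENNReal) s ≤
              ((Finset.univ.filter fun σ : Fin n → Bool => swapBy σ s ∈ B).card : ENNReal) := by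
            rw [Finset.card_filter, Nat.cast_sum]
            refine Finset.sum_le_sum fun σ _ => ?_
            by_cases hσ : swapBy σ s ∈ B'
            · simp [hσ, hsub hσ]
            · simp [hσ]
          refine h2.trans ?_
          have h3 := ENNReal.ofReal_le_ofReal (h s)
          rw [ENNReal.ofReal_natCast, ENNReal.ofReal_mul (by positivity),
            ENNReal.ofReal_pow (by norm_num)] at h3
          simpa using h3
      _ = _ := by simp
  exact (ENNReal.mul_le_mul_iff_right (by simp) (by simp)).1 h1

end Symmetrization

/-! ### Uniform deviation bounds -/

lemma half_le_measure {α : Type*} [MeasurableSpace α] {μ : Measure α} [IsProbabilityMeasure μ]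
    {E B : Set α} (hE : μ E ≤ ENNReal.ofReal (1 / 2)) (h : ∀ t ∉ E, t ∈ B) : 2⁻¹ ≤ μ B := by
  have h1 : (1 : ENNReal) ≤ μ E + μ B := by
    rw [← measure_univ (μ := μ)]
    refine (measure_mono fun t _ => ?_).trans (measure_union_le E B)
    by_cases ht : t ∈ E
    · exact Or.inl ht
    · exact Or.inr (h t ht)
  rw [show ENNReal.ofReal (1 / 2) = 2⁻¹ by
    rw [one_div, ENNReal.ofReal_inv_of_pos (by norm_num)]; norm_num] at hE
  have h2 : (2⁻¹ : ENNReal) + 2⁻¹ ≤ 2⁻¹ + μ B := by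
    rw [ENNReal.inv_two_add_inv_two]
    exact h1.trans (by gcongr)
  exact (ENNReal.add_le_add_iff_left (by simp)).1 h2

lemma exists_of_lt_disc {X ι κ : Type*} [Fintype ι] [Fintype κ] {H : Set (X → Bool)}
    {S : ι → Ex X} {T : κ → Ex X} {ε : ℝ} (hε : 0 ≤ ε) (h : ε < disc H S T) :
    ∃ h ∈ H, ε < |empRisk S h - empRisk T h| := by
  by_contra! hcon
  exact h.not_ge (Real.iSup_le (fun g => hcon g g.2) hε)

lemma exists_of_lt_disp {X ι κ : Type*} [Fintype ι] [Fintype κ] {H : Set (X → Bool)}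
    {S : ι → Ex X} {T : κ → Ex X} {ε : ℝ} (hε : 0 ≤ ε) (h : ε < disp H S T) :
    ∃ h ∈ H, ε < |empDpViolation S h - empDpViolation T h| := by
  by_contra! hcon
  exact h.not_ge (Real.iSup_le (fun g => hcon g g.2) hε)

lemma empDpViolation_sub_le {X ι : Type*} [Fintype ι] {S : ι → Ex X} {f : X → Bool}
    {a g : Bool → ℝ} {c : ℝ} (hc : 0 < c) (hg : ∀ b, c ≤ g b) :
    |empDpViolation S f - (|a true / g true - a false / g false|)| ≤
      ((|empMean (grpInd true) S - g true| + |empMean (accInd true f) S - a true|) +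
        (|empMean (grpInd false) S - g false| + |empMean (accInd false f) S - a false|)) / c := by
  have key : ∀ b, |empGroupRate S f b - a b / g b| ≤
      (|empMean (grpInd b) S - g b| + |empMean (accInd b f) S - a b|) / c := fun b => by
    rw [empGroupRate_eq]
    refine (abs_div_sub_div_le (empMean_mem_Icc (accInd_mem_Icc b f) S).1
      (empMean_mono (accInd_le_grpInd b f) S) (hc.trans_le (hg b))).trans ?_
    exact div_le_div_of_nonneg_left (by positivity) hc (hg b)
  rw [add_div]
  exact (abs_abs_sub_sub_abs_sub_le _ _ _ _).trans (add_le_add (key true) (key false))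

section Deviation

variable {X : Type*} [MeasurableSpace X] (p : Measure (Ex X)) [IsProbabilityMeasure p]
  {H : Set (X → Bool)} {d n : ℕ} {ε τ : ℝ}

/-- Uniform convergence of the empirical risk. -/
lemma measure_risk_dev_le (hd : vcDim H = d) (hH : ∀ h ∈ H, Measurable h) (hn : 0 < n)
    (hε : 0 < ε) (hcheb : 1 / (n * ε ^ 2) ≤ 1 / 2)
    (hdisc : AEMeasurable (fun s : (Fin n → Ex X) × (Fin n → Ex X) => disc H s.1 s.2)
      ((Measure.pi fun _ => p).prod (Measure.pi fun _ => p))) :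
    Measure.pi (fun _ : Fin n => p) {s | ∃ h ∈ H, 2 * ε < |empRisk s h - risk p h|} ≤
      ENNReal.ofReal (2 * vcTail d n ε) := by
  classical
  let B : Set ((Fin n → Ex X) × (Fin n → Ex X)) := {s | ε < disc H s.1 s.2}
  have hB : NullMeasurableSet B
      ((Measure.pi fun _ : Fin n => p).prod (Measure.pi fun _ : Fin n => p)) :=
    nullMeasurableSet_lt aemeasurable_const hdisc
  have hBle : (Measure.pi fun _ : Fin n => p).prod (Measure.pi fun _ : Fin n => p) B ≤
      ENNReal.ofReal (vcTail d n ε) := by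
    refine measure_le_of_card_swapBy_le p hB fun s => le_trans (Nat.cast_le.2 ?_)
      (card_swapBy_le hd hn (φ := errInd) errInd_mem_Icc (fun h h' z hz => by simp [errInd, hz])
        hε.le s)
    refine Finset.card_le_card fun σ hσ => Finset.mem_filter.2 ⟨Finset.mem_univ _, ?_⟩
    simpa only [empRisk_eq] using exists_of_lt_disc hε.le (Finset.mem_filter.1 hσ).2
  refine (measure_le_two_mul_prod (B := B) ?_).trans ?_
  · rintro s ⟨h, hh, hs⟩
    refine half_le_measure ((measure_empMean_dev_le p (measurable_errInd (hH h hh))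
      (errInd_mem_Icc h) hn hε).trans (ENNReal.ofReal_le_ofReal hcheb)) fun t ht => ?_
    rw [Set.mem_ofPred_eq, not_le, ← empRisk_eq, ← risk_eq_integral p (hH h hh)] at ht
    have h1 := abs_sub_le (empRisk s h) (empRisk t h) (risk p h)
    have h2 := abs_empRisk_sub_le_disc s t hh
    change ε < disc H s t
    linarith
  · rw [ENNReal.ofReal_mul (by norm_num)]
    gcongr
    simp

/-- Uniform convergence of the empirical parity violation. The event to which symmetrization is
applied also asks that no group be too small in the second sample; then rates differ by `ε` only if
one of four empirical means of indicators differs by `ε * τ / 8`. -/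
lemma measure_dpViolation_dev_le (hd : vcDim H = d) (hH : ∀ h ∈ H, Measurable h) (hn : 0 < n)
    (hε : 0 < ε) (hε2 : ε ≤ 2) (hτ : 0 < τ) (hτp : ∀ b, τ ≤ groupProb p b)
    (hcheb : 1 / (n * (ε * τ / 4) ^ 2) ≤ 1 / 8)
    (hdisp : AEMeasurable (fun s : (Fin n → Ex X) × (Fin n → Ex X) => disp H s.1 s.2)
      ((Measure.pi fun _ => p).prod (Measure.pi fun _ => p))) :
    Measure.pi (fun _ : Fin n => p)
        {s | ∃ h ∈ H, 2 * ε < |empDpViolation s h - dpViolation p h|} ≤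
      ENNReal.ofReal (2 * (4 * vcTail d n (ε * τ / 8))) := by
  classical
  let B : Set ((Fin n → Ex X) × (Fin n → Ex X)) :=
    {s | ε < disp H s.1 s.2} ∩ ⋂ b, {s | τ / 2 ≤ empMean (grpInd b) s.2}
  have hB : NullMeasurableSet B
      ((Measure.pi fun _ : Fin n => p).prod (Measure.pi fun _ : Fin n => p)) := by
    refine (nullMeasurableSet_lt aemeasurable_const hdisp).inter
      (MeasurableSet.iInter fun b => measurableSet_le measurable_const ?_).nullMeasurableSet
    exact (measurable_empMean (measurable_grpInd b)).comp measurable_snd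
  have hBle : (Measure.pi fun _ : Fin n => p).prod (Measure.pi fun _ : Fin n => p) B ≤
      ENNReal.ofReal (4 * vcTail d n (ε * τ / 8)) := by
    refine measure_le_of_card_swapBy_le p hB fun s => ?_
    let E : ((X → Bool) → Ex X → ℝ) → Finset (Fin n → Bool) := fun φ =>
      Finset.univ.filter fun σ => ∃ h ∈ H,
        ε * τ / 8 < |empMean (φ h) (swapBy σ s).1 - empMean (φ h) (swapBy σ s).2|
    have hacc : ∀ b, ((E (accInd b)).card : ℝ) ≤ 2 ^ n * vcTail d n (ε * τ / 8) := fun b =>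
      card_swapBy_le hd hn (accInd_mem_Icc b) (fun h h' z hz => by simp [accInd, hz])
        (by positivity) s
    have hgrp : ∀ b, ((E fun _ => grpInd b).card : ℝ) ≤ 2 ^ n * vcTail d n (ε * τ / 8) :=
      fun b => card_swapBy_le hd hn (fun _ => grpInd_mem_Icc b) (fun _ _ _ _ => rfl)
        (by positivity) s
    have hsum : ((((E fun _ => grpInd true) ∪ E (accInd true)) ∪
        ((E fun _ => grpInd false) ∪ E (accInd false))).card : ℝ) ≤
        2 ^ n * (4 * vcTail d n (ε * τ / 8)) := by
      have hcard : ((((E fun _ => grpInd true) ∪ E (accInd true)) ∪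
          ((E fun _ => grpInd false) ∪ E (accInd false))).card : ℝ) ≤ _ :=
        Nat.cast_le.2 ((Finset.card_union_le _ _).trans
          (add_le_add (Finset.card_union_le _ _) (Finset.card_union_le _ _)))
      push_cast at hcard
      have h1 := hacc true
      have h2 := hacc false
      have h3 := hgrp true
      have h4 := hgrp false
      linarith
    refine (Nat.cast_le.2 (Finset.card_le_card fun σ hσ => ?_)).trans hsum
    obtain ⟨hσd, hσc⟩ :=
      ((@Finset.mem_filter _ _ (fun _ => Classical.propDecidable _) _ _).1 hσ).2
    rw [Set.mem_iInter] at hσc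
    obtain ⟨h, hh, hlt⟩ := exists_of_lt_disp hε.le hσd
    have key := empDpViolation_sub_le (S := (swapBy σ s).1) (f := h)
      (a := fun b => empMean (accInd b h) (swapBy σ s).2) (half_pos hτ) hσc
    simp only [← empGroupRate_eq] at key
    change |empDpViolation _ h - empDpViolation _ h| ≤ _ at key
    rw [le_div_iff₀ (half_pos hτ)] at key
    have hlt' := mul_lt_mul_of_pos_right hlt (half_pos hτ)
    simp only [E, Finset.mem_union, Finset.mem_filter, Finset.mem_univ, true_and]
    by_contra! hcon
    have h1 := hcon.1.1 h hh
    have h2 := hcon.1.2 h hh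
    have h3 := hcon.2.1 h hh
    have h4 := hcon.2.2 h hh
    linarith
  refine (measure_le_two_mul_prod (B := B) ?_).trans ?_
  · rintro s ⟨h, hh, hs⟩
    have hε' : 0 < ε * τ / 4 := by positivity
    let D : (Ex X → ℝ) → Set (Fin n → Ex X) := fun φ =>
      {t | ε * τ / 4 ≤ |empMean φ t - ∫ z, φ z ∂p|}
    have hD : ∀ φ : Ex X → ℝ, Measurable φ → (∀ z, φ z ∈ Set.Icc (0 : ℝ) 1) →
        Measure.pi (fun _ : Fin n => p) (D φ) ≤ ENNReal.ofReal (1 / 8) := fun φ h1 h2 =>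
      (measure_empMean_dev_le p h1 h2 hn hε').trans (ENNReal.ofReal_le_ofReal hcheb)
    refine half_le_measure (E := (D (grpInd true) ∪ D (accInd true h)) ∪
      (D (grpInd false) ∪ D (accInd false h))) ?_ fun t ht => ?_
    · refine (measure_union_le _ _).trans ((add_le_add (measure_union_le _ _)
        (measure_union_le _ _)).trans ?_)
      refine (add_le_add (add_le_add (hD _ (measurable_grpInd _) (grpInd_mem_Icc _))
        (hD _ (measurable_accInd _ (hH h hh)) (accInd_mem_Icc _ _)))
        (add_le_add (hD _ (measurable_grpInd _) (grpInd_mem_Icc _))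
        (hD _ (measurable_accInd _ (hH h hh)) (accInd_mem_Icc _ _)))).trans_eq ?_
      rw [← ENNReal.ofReal_add (by norm_num) (by norm_num),
        ← ENNReal.ofReal_add (by norm_num) (by norm_num)]
      norm_num
    · simp only [D, Set.mem_union, not_or, Set.mem_ofPred_eq, not_le,
        ← groupProb_eq_integral] at ht
      obtain ⟨⟨h1, h2⟩, h3, h4⟩ := ht
      have key := empDpViolation_sub_le (S := t) (f := h) (a := fun b => ∫ z, accInd b h z ∂p)
        hτ hτp
      have hdp : |(∫ z, accInd true h z ∂p) / groupProb p true -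
          (∫ z, accInd false h z ∂p) / groupProb p false| = dpViolation p h := by
        simp only [dpViolation, groupRate_eq_integral p (hH h hh), groupProb_eq_integral]
      simp only [hdp] at key
      have hlt : |empDpViolation t h - dpViolation p h| < ε := by
        refine key.trans_lt ?_
        rw [div_lt_iff₀ hτ]
        linarith
      have h5 := abs_sub_le (empDpViolation s h) (empDpViolation t h) (dpViolation p h)
      have h6 := abs_empDpViolation_sub_le_disp s t hh
      refine ⟨?_, Set.mem_iInter.2 fun b => ?_⟩
      · change ε < disp H s t
        linarith
      · change τ / 2 ≤ empMean (grpInd b) t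
        have h7 : |empMean (grpInd b) t - groupProb p b| < ε * τ / 4 := by cases b <;> assumption
        have h8 := (abs_lt.1 h7).1
        have h9 := hτp b
        nlinarith
  · rw [ENNReal.ofReal_mul (p := 2) (by norm_num)]
    gcongr
    simp

/-- A bound for the probability that a sample is not representative. -/
noncomputable def failBound (d n : ℕ) (τ ε : ℝ) : ℝ :=
  2 * vcTail d n ε + 2 * (4 * vcTail d n (ε * τ / 8)) + 1 / (n * ε ^ 2)

lemma measure_not_isRepresentative_le (hd : vcDim H = d) (hH : ∀ h ∈ H, Measurable h)
    (hn : 0 < n) (hε : 0 < ε) (hε2 : ε ≤ 2) (hτ : 0 < τ) (hτp : ∀ b, τ ≤ groupProb p b)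
    (hcheb : 1 / (n * ε ^ 2) ≤ 1 / 2) (hcheb' : 1 / (n * (ε * τ / 4) ^ 2) ≤ 1 / 8)
    (hdisc : AEMeasurable (fun s : (Fin n → Ex X) × (Fin n → Ex X) => disc H s.1 s.2)
      ((Measure.pi fun _ => p).prod (Measure.pi fun _ => p)))
    (hdisp : AEMeasurable (fun s : (Fin n → Ex X) × (Fin n → Ex X) => disp H s.1 s.2)
      ((Measure.pi fun _ => p).prod (Measure.pi fun _ => p))) :
    Measure.pi (fun _ : Fin n => p)
        {s | ¬ IsRepresentative H (risk p) (dpViolation p) (groupProb p true) (2 * ε) s} ≤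
      ENNReal.ofReal (failBound d n τ ε) := by
  have h1 := measure_risk_dev_le p hd hH hn hε hcheb hdisc
  have h2 := measure_dpViolation_dev_le p hd hH hn hε hε2 hτ hτp hcheb' hdisp
  have h3 := measure_empMean_dev_le p (measurable_grpInd (X := X) true) (grpInd_mem_Icc true) hn hε
  rw [← groupProb_eq_integral] at h3
  have t1 := vcTail_nonneg d n ε
  have t2 := vcTail_nonneg d n (ε * τ / 8)
  rw [failBound, ENNReal.ofReal_add (by positivity) (by positivity),
    ENNReal.ofReal_add (by positivity) (by positivity)]
  refine le_trans (measure_mono fun s hs => ?_) ((measure_union_le _ _).trans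
    (add_le_add ((measure_union_le _ _).trans (add_le_add h1 h2)) h3))
  by_contra hcon
  simp only [Set.mem_union, not_or, Set.mem_ofPred_eq, not_exists, not_and, not_lt, not_le]
    at hcon
  exact hs ⟨hcon.1.1, hcon.1.2, by linarith [hcon.2]⟩

end Deviation

/-! ### The rate `log n / √n` -/

open Filter Topology

/-- The common rate `√(1 / n) * log n` of all deviations. -/
noncomputable def rate (n : ℕ) : ℝ := Real.sqrt (1 / n) * Real.log n

lemma softO_const_mul_rate (c : ℝ) :
    SoftO (fun n => c * rate n) (fun n => Real.sqrt (1 / n)) :=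
  ⟨1, by
    simp only [pow_one]
    exact (Asymptotics.isBigO_refl rate atTop).const_mul_left c⟩

lemma nat_mul_rate_sq (n : ℕ) : n * rate n ^ 2 = Real.log n ^ 2 := by
  rcases Nat.eq_zero_or_pos n with rfl | hn
  · simp
  · have : (n : ℝ) ≠ 0 := by positivity
    rw [rate, mul_pow, Real.sq_sqrt (by positivity)]
    field_simp

lemma tendsto_log_natCast : Tendsto (fun n : ℕ => Real.log n) atTop atTop :=
  Real.tendsto_log_atTop.comp tendsto_natCast_atTop_atTop

lemma tendsto_rate : Tendsto rate atTop (𝓝 0) := by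
  have h1 : Tendsto (fun x : ℝ => Real.log x / x ^ (1 / 2 : ℝ)) atTop (𝓝 0) :=
    (isLittleO_log_rpow_atTop (by norm_num)).tendsto_div_nhds_zero
  refine (h1.comp tendsto_natCast_atTop_atTop).congr fun n => ?_
  simp only [Function.comp, rate]
  rw [← Real.sqrt_eq_rpow, one_div, Real.sqrt_inv, div_eq_inv_mul]

/-- The factor `exp (-c * (log n) ^ 2)` beats every power of `n`. -/
lemma tendsto_vcTail_rate (d : ℕ) {c : ℝ} (hc : 0 < c) :
    Tendsto (fun n => vcTail d n (rate n * c)) atTop (𝓝 0) := by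
  have h1 : Tendsto (fun n : ℕ => Real.log n * (c ^ 2 / 2 * Real.log n - d)) atTop atTop :=
    tendsto_log_natCast.atTop_mul_atTop₀
      (tendsto_atTop_add_const_right _ _ (tendsto_log_natCast.const_mul_atTop (by positivity)))
  have h2 := (Real.tendsto_exp_atBot.comp (tendsto_neg_atTop_atBot.comp h1)).const_mul
    ((d + 1) * 2 ^ d * 2 : ℝ)
  rw [mul_zero] at h2
  refine h2.congr' ?_
  filter_upwards [eventually_gt_atTop 0] with n hn
  have hn' : (0 : ℝ) < n := by exact_mod_cast hn
  have h3 : (n : ℝ) ^ d = Real.exp (d * Real.log n) := by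
    rw [Real.exp_nat_mul, Real.exp_log hn']
  rw [vcTail, mul_pow 2 (n : ℝ), h3, mul_pow (rate n), ← mul_assoc (n : ℝ),
    nat_mul_rate_sq]
  simp only [Function.comp]
  rw [show -(Real.log n * (c ^ 2 / 2 * Real.log n - d)) =
    d * Real.log n + -(Real.log n ^ 2 * c ^ 2 / 2) by ring, Real.exp_add]
  ring

lemma tendsto_one_div_mul_rate_sq (c : ℝ) :
    Tendsto (fun n : ℕ => 1 / (n * (rate n * c) ^ 2)) atTop (𝓝 0) := by
  have h1 : Tendsto (fun n : ℕ => (Real.log n ^ 2)⁻¹) atTop (𝓝 0) :=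
    tendsto_inv_atTop_zero.comp ((tendsto_pow_atTop two_ne_zero).comp tendsto_log_natCast)
  have h2 := h1.mul_const ((c ^ 2)⁻¹)
  rw [zero_mul] at h2
  refine h2.congr fun n => ?_
  rw [mul_pow, ← mul_assoc, nat_mul_rate_sq, one_div, mul_inv]

lemma tendsto_failBound_rate (d : ℕ) {τ : ℝ} (hτ : 0 < τ) :
    Tendsto (fun n => failBound d n τ (rate n)) atTop (𝓝 0) := by
  have h1 := (tendsto_vcTail_rate d one_pos).const_mul 2
  have h2 := ((tendsto_vcTail_rate d (c := τ / 8) (by positivity)).const_mul 4).const_mul 2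
  have h3 := tendsto_one_div_mul_rate_sq 1
  simp only [mul_one, mul_zero] at h1 h2 h3
  have h := (h1.add h2).add h3
  simp only [add_zero, ← mul_div_assoc] at h
  exact h

/-! ### Robustness of the merged dataset -/

lemma groupProb_false {X : Type*} [MeasurableSpace X] (p : Measure (Ex X))
    [IsProbabilityMeasure p] : groupProb p false = 1 - groupProb p true := by
  have hm : MeasurableSet {z : Ex X | z.2.2 = true} :=
    measurableSet_eq_fun (by fun_prop) (by fun_prop)
  rw [groupProb, groupProb, ← probReal_compl_eq_one_sub hm]
  congr 1
  ext z
  simp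

/-- If all clean sources are representative, then no adversary can harm the merged dataset. -/
lemma pool_filterSources_le {X : Type*} [MeasurableSpace X] {p : Measure (Ex X)}
    [IsProbabilityMeasure p] {H : Set (X → Bool)} {N n K : ℕ} {α τ ε : ℝ} (hn : 0 < n)
    (hε : 0 ≤ ε) (hτ : 0 < τ) (hτp : ∀ b, τ ≤ groupProb p b) (hK : (N : ℝ) / 2 < K)
    (hα : 1 / 2 ≤ α) (hαK : α ≤ (K : ℝ) / N) {clean S : Fin N → Fin n → Ex X}
    (hrep : ∀ i,
      IsRepresentative H (risk p) (dpViolation p) (groupProb p true) (2 * ε) (clean i))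
    (hS : IsCorruption K clean S) {f : X → Bool} (hf : f ∈ H) :
    empRisk (pool S (filterSources H α S)) f ≤ risk p f + 6 * ε ∧
      empDpViolation (pool S (filterSources H α S)) f ≤
        dpViolation p f + (6 + 24 / τ) * ε := by
  have : Nonempty (Fin n) := ⟨⟨0, hn⟩⟩
  obtain ⟨G, hG, hGS⟩ := hS
  have hI : ∀ i ∈ filterSources H α S,
      IsRepresentative H (risk p) (dpViolation p) (groupProb p true) (3 * (2 * ε)) (S i) :=
    fun i hi => isRepresentative_of_mem_filterSources (by positivity) hK hα hαK hG
      (fun j hj => hGS j hj ▸ hrep j) hi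
  have hR : 0 ≤ risk p f := measureReal_nonneg
  have hΓ : 0 ≤ dpViolation p f := abs_nonneg _
  constructor
  · refine empRisk_pool_le (by positivity) fun i hi => ?_
    linarith [(abs_le.1 ((hI i hi).1 f hf)).2]
  · have key := empDpViolation_pool_le (S := S) (I := filterSources H α S) (f := f)
      (π := groupProb p) (c := dpViolation p f + 6 * ε) (η := 6 * ε) (by positivity)
      (by positivity) hτ hτp (fun b i hi => ?_) fun i hi => ?_
    · refine key.trans_eq ?_
      field_simp
      ring
    · have h := (hI i hi).2.2
      cases b
      · rw [empMean_grpInd_false, groupProb_false, sub_sub_sub_cancel_left, abs_sub_comm]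
        linarith
      · linarith
    · linarith [(abs_le.1 ((hI i hi).2.1 f hf)).2]

end FairMulti

theorem theorem1 (d : ℕ) (τ : ℝ) (hτ : 0 < τ) :
    ∃ εR εΓ : ℕ → ℝ,
      SoftO εR (fun n => Real.sqrt (1 / n)) ∧ SoftO εΓ (fun n => Real.sqrt (1 / n)) ∧
      ∀ (N : ℕ) (δ : ℝ), 0 < δ → ∃ C : ℕ,
        ∀ (X : Type*) [MeasurableSpace X] (p : Measure (Ex X)) [IsProbabilityMeasure p]
          (H : Set (X → Bool)) (K : ℕ) (α : ℝ) (n : ℕ),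
          min (groupProb p false) (groupProb p true) = τ →
          vcDim H = d →
          (∀ h ∈ H, Measurable h) →
          AEMeasurable (fun s : (Fin n → Ex X) × (Fin n → Ex X) => disc H s.1 s.2)
            ((Measure.pi fun _ => p).prod (Measure.pi fun _ => p)) →
          AEMeasurable (fun s : (Fin n → Ex X) × (Fin n → Ex X) => disp H s.1 s.2)
            ((Measure.pi fun _ => p).prod (Measure.pi fun _ => p)) →
          (N : ℝ) / 2 < K → 1 / 2 ≤ α → α ≤ (K : ℝ) / N →
          C ≤ n →
          ∀ (Ω : Type*) [MeasurableSpace Ω] (P : Measure Ω) [IsProbabilityMeasure P]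
            (clean : Fin N → Fin n → Ω → Ex X),
            (∀ i j, Measurable (clean i j)) →
            (∀ i, iIndepFun (clean i) P) →
            (∀ i j, P.map (clean i j) = p) →
            P {ω | ¬ ∀ S : Fin N → Fin n → Ex X,
                IsCorruption K (fun i j => clean i j ω) S →
                ∀ f ∈ H,
                  empRisk (pool S (filterSources H α S)) f ≤ risk p f + εR n ∧
                  empDpViolation (pool S (filterSources H α S)) f ≤ dpViolation p f + εΓ n}
              ≤ ENNReal.ofReal δ := by
  refine ⟨fun n => 6 * rate n, fun n => (6 + 24 / τ) * rate n, softO_const_mul_rate _,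
    softO_const_mul_rate _, fun N δ hδ => ?_⟩
  have hfail := (tendsto_failBound_rate d hτ).const_mul (N : ℝ)
  rw [mul_zero] at hfail
  have hcheb := tendsto_one_div_mul_rate_sq 1
  simp only [mul_one] at hcheb
  have hev := (hfail.eventually_le_const hδ).and <|
    (tendsto_rate.eventually_le_const (show (0 : ℝ) < 2 by norm_num)).and <|
    (hcheb.eventually_le_const (show (0 : ℝ) < 1 / 2 by norm_num)).and <|
    ((tendsto_one_div_mul_rate_sq (τ / 4)).eventually_le_const
      (show (0 : ℝ) < 1 / 8 by norm_num)).and (Filter.eventually_gt_atTop 1)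
  obtain ⟨C, hC⟩ := Filter.eventually_atTop.1 hev
  refine ⟨C, ?_⟩
  intro X _ p _ H K α n hτp hd hH hdisc hdisp hK hα hαK hCn Ω _ P _ clean hclean hindep hlaw
  obtain ⟨hfail, hrate2, hcheb, hcheb', hn1⟩ := hC n hCn
  have hn : 0 < n := by omega
  have hrate : 0 < rate n := mul_pos (Real.sqrt_pos.2 (by positivity))
    (Real.log_pos (by exact_mod_cast hn1))
  have hτb : ∀ b, τ ≤ groupProb p b := by
    rw [← hτp]
    rintro (_ | _)
    exacts [min_le_left _ _, min_le_right _ _]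
  rw [← mul_div_assoc] at hcheb'
  have hone := measure_not_isRepresentative_le p hd hH hn hrate hrate2 hτ hτb hcheb hcheb'
    hdisc hdisp
  let A : Set (Fin n → Ex X) :=
    {s | ¬ IsRepresentative H (risk p) (dpViolation p) (groupProb p true) (2 * rate n) s}
  have hbad : ∀ i, P ((fun ω j => clean i j ω) ⁻¹' A) ≤
      ENNReal.ofReal (failBound d n τ (rate n)) := by
    intro i
    have hmeas : Measurable fun ω j => clean i j ω := measurable_pi_lambda _ (hclean i)
    have hmap : P.map (fun ω j => clean i j ω) = Measure.pi fun _ => p := by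
      rw [(iIndepFun_iff_map_fun_eq_pi_map fun j => (hclean i j).aemeasurable).1 (hindep i)]
      simp only [hlaw]
    have := Measure.le_map_apply hmeas.aemeasurable (μ := P) A
    rw [hmap] at this
    exact this.trans hone
  -- the sources need not be independent of each other: a union bound suffices
  calc _ ≤ P (⋃ i, (fun ω j => clean i j ω) ⁻¹' A) := by
        refine measure_mono fun ω hω => ?_
        by_contra hcon
        simp only [Set.mem_iUnion, not_exists] at hcon
        exact hω fun S hS f hf => pool_filterSources_le hn hrate.le hτ hτb hK hα hαK
          (fun i => not_not.1 (hcon i)) hS hf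
    _ ≤ ∑ i, P ((fun ω j => clean i j ω) ⁻¹' A) := measure_iUnion_fintype_le _ _
    _ ≤ ∑ _ : Fin N, ENNReal.ofReal (failBound d n τ (rate n)) :=
        Finset.sum_le_sum fun i _ => hbad i
    _ = ENNReal.ofReal (N * failBound d n τ (rate n)) := by
        rw [ENNReal.ofReal_mul (by positivity)]
        simp
    _ ≤ ENNReal.ofReal δ := ENNReal.ofReal_le_ofReal hfail
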